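/- Let $\mathcal A$ be a Banach $*$-algebra over $\mathbb C$ (an associative, complete normed complex algebra with a continuous involution) which is not assumed to be unital. Assume that $\mathcal A$ is zero product determined, i.e. every continuous bilinear map $\varphi:\mathcal A\times\mathcal A\to X$ into a Banach space $X$ with $\varphi(a,b)=0$ whenever $ab=0$ has the form $\varphi(a,b)=T(ab)$ for some continuous linear map $T:\mathcal A\to X$. Assume also that $\mathcal A$ has a bounded approximate identity, i.e. a norm-bounded net $(e_i)$ of self-adjoint elements with $\|ae_i-a\|\to0$ and $\|e_ia-a\|\to0$ for every $a\in\mathcal A$. Let $\mathcal M$ be an essential Banach $*$-$\mathcal A$-bimodule: a Banach space with bounded bilinear, commuting, associative left and right actions of $\mathcal A$ and a continuous conjugate-linear involution $m\mapsto m^*$ with $(am)^*=m^*a^*$ and $(ma)^*=a^*m^*$, such that the linear span of $\{amb: a,b\in\mathcal A,\ m\in\mathcal M\}$ is dense in $\mathcal M$. For a Banach $\mathcal A$-bimodule $E$, the dual $E^\sharp$ is a Banach $\mathcal A$-bimodule under $(a\cdot\rho)(x)=\rho(xa)$, $(\rho\cdot a)(x)=\rho(ax)$, and an involution on $E$ induces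 one on $E^\sharp$ by $\rho^*(x)=\overline{\rho(x^*)}$. In this way the second dual $\mathcal M^{\sharp\sharp}$ is a Banach $*$-$\mathcal A$-bimodule, which contains $\mathcal M$ canonically. Let $\delta:\mathcal A\to\mathcal M$ be a continuous linear map such that, for all $a,b\in\mathcal A$, $$ab^*=0\ \Longrightarrow\ a\,\delta(b)^*+\delta(a)\,b^*=0 .$$ Then there exist a $*$-derivation $\Delta:\mathcal A\to\mathcal M^{\sharp\sharp}$ (a linear map with $\Delta(ab)=a\cdot\Delta(b)+\Delta(a)\cdot b$ and $\Delta(a^*)=\Delta(a)^*$ for all $a,b\in\mathcal A$) and an element $\xi\in\mathcal M^{\sharp\sharp}$ such that $$\delta(a)=\Delta(a)+\xi\cdot a\qquad\text{for every } a\in\mathcal A .$$ Furthermore, $\xi$ can be chosen in $\mathcal M$ in each of the following cases: (1) $\mathcal A$ is unital; (2) $\mathcal M$ is a dual bimodule, i.e. $\mathcal M$ is isomorphic (linearly, homeomorphically and compatibly with both actions) to $E^\sharp$ for some Banach $\mathcal A$-bimodule $E$. -/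

import Mathlib

open Filter Topology

universe u v w

/-- A Banach bimodule over the (not necessarily unital) normed algebra `A`: the two module actions
are bounded bilinear maps satisfying the associativity laws (completeness of `M` is a separate
hypothesis). `lact a m` is `a · m` and `ract a m` is `m · a`. -/
class BanachBimodule (A : Type u) (M : Type v) [NonUnitalNormedRing A] [NormedSpace ℂ A]
    [NormedAddCommGroup M] [NormedSpace ℂ M] where
  lact : A →L[ℂ] M →L[ℂ] M
  ract : A →L[ℂ] M →L[ℂ] M
  lact_mul : ∀ (a b : A) (m : M), lact (a * b) m = lact a (lact b m)
  ract_mul : ∀ (a b : A) (m : M), ract (a * b) m = ract b (ract a m)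
  lact_ract : ∀ (a b : A) (m : M), lact a (ract b m) = ract b (lact a m)

/-- The left action `a · m`. -/
noncomputable abbrev lmulBimod {A : Type u} {M : Type v} [NonUnitalNormedRing A] [NormedSpace ℂ A]
    [NormedAddCommGroup M] [NormedSpace ℂ M] [BanachBimodule A M] (a : A) (m : M) : M :=
  BanachBimodule.lact a m

/-- The right action `m · a`. -/
noncomputable abbrev rmulBimod {A : Type u} {M : Type v} [NonUnitalNormedRing A] [NormedSpace ℂ A]
    [NormedAddCommGroup M] [NormedSpace ℂ M] [BanachBimodule A M] (m : M) (a : A) : M :=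
  BanachBimodule.ract a m

/-- `a ⊳ₗ m` is the left action `a · m`. -/
notation:73 a:74 " ⊳ₗ " m:73 => lmulBimod a m

/-- `m ⊲ᵣ a` is the right action `m · a`. -/
notation:73 m:73 " ⊲ᵣ " a:74 => rmulBimod m a

/-- A Banach `*`-bimodule over a normed `*`-algebra: the conjugate-linear continuous involution
on `M` (given by the classes `StarAddMonoid`, `StarModule ℂ`, `ContinuousStar`) satisfies
`(a · m)* = m* · a*` and `(m · a)* = a* · m*`. -/
class BanachStarBimodule (A : Type u) (M : Type v) [NonUnitalNormedRing A] [NormedSpace ℂ A]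
    [StarRing A] [NormedAddCommGroup M] [NormedSpace ℂ M] [StarAddMonoid M] [StarModule ℂ M]
    [ContinuousStar M] [BanachBimodule A M] : Prop where
  star_lact : ∀ (a : A) (m : M), star (a ⊳ₗ m) = star m ⊲ᵣ star a
  star_ract : ∀ (a : A) (m : M), star (m ⊲ᵣ a) = star a ⊳ₗ star m

section Dual

variable {A : Type u} {M : Type v} [NonUnitalNormedRing A] [NormedSpace ℂ A]
  [NormedAddCommGroup M] [NormedSpace ℂ M]

/-- The dual of a Banach bimodule: `(a · ρ)(m) = ρ(m · a)` and `(ρ · a)(m) = ρ(a · m)`.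
Applied twice, it gives `(a · Λ)(ρ) = Λ(ρ · a)` and `(Λ · a)(ρ) = Λ(a · ρ)` on the second dual,
i.e. the weak-star continuous extensions of the actions on `M`. -/
noncomputable instance StrongDual.instBanachBimodule [BanachBimodule A M] :
    BanachBimodule A (StrongDual ℂ M) where
  lact := (ContinuousLinearMap.compL ℂ M M ℂ).flip.comp BanachBimodule.ract
  ract := (ContinuousLinearMap.compL ℂ M M ℂ).flip.comp BanachBimodule.lact
  lact_mul a b ρ := by
    ext m
    simp [BanachBimodule.ract_mul]
  ract_mul a b ρ := by
    ext m
    simp [BanachBimodule.lact_mul]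
  lact_ract a b ρ := by
    ext m
    simp [BanachBimodule.lact_ract]

theorem StrongDual.lact_apply [BanachBimodule A M] (a : A) (ρ : StrongDual ℂ M) (m : M) :
    (a ⊳ₗ ρ) m = ρ (m ⊲ᵣ a) := rfl

theorem StrongDual.ract_apply [BanachBimodule A M] (a : A) (ρ : StrongDual ℂ M) (m : M) :
    (ρ ⊲ᵣ a) m = ρ (a ⊳ₗ m) := rfl

variable [StarAddMonoid M] [StarModule ℂ M] [ContinuousStar M]

/-- The involution on the dual space: `ρ*(m)` is the complex conjugate of `ρ(m*)`. -/
noncomputable instance StrongDual.instStarOfStar : Star (StrongDual ℂ M) where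
  star ρ :=
    { toFun := fun m => star (ρ (star m))
      map_add' := fun m n => by simp
      map_smul' := fun c m => by simp
      cont := (ρ.continuous.comp continuous_star).star }

theorem StrongDual.star_apply_eq (ρ : StrongDual ℂ M) (m : M) :
    (star ρ) m = star (ρ (star m)) := rfl

noncomputable instance StrongDual.instStarAddMonoidOfStar : StarAddMonoid (StrongDual ℂ M) where
  star_involutive ρ := by
    ext m
    simp [StrongDual.star_apply_eq]
  star_add ρ σ := by
    ext m
    simp [StrongDual.star_apply_eq]

instance StrongDual.instStarModuleOfStar : StarModule ℂ (StrongDual ℂ M) where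
  star_smul c ρ := by
    ext m
    simp [StrongDual.star_apply_eq]

instance StrongDual.instContinuousStarOfStar : ContinuousStar (StrongDual ℂ M) where
  continuous_star := by
    obtain ⟨C, hC, hb⟩ :=
      SemilinearMapClass.bound_of_continuous (starL ℂ : M ≃L⋆[ℂ] M) continuous_star
    refine AddMonoidHomClass.continuous_of_bound (starAddEquiv : StrongDual ℂ M ≃+ _) C ?_
    intro ρ
    refine ContinuousLinearMap.opNorm_le_bound _ (by positivity) fun m => ?_
    have h1 : ‖ρ (star m)‖ ≤ ‖ρ‖ * ‖star m‖ := ρ.le_opNorm _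
    have h2 : ‖star m‖ ≤ C * ‖m‖ := hb m
    calc ‖star (ρ (star m))‖ = ‖ρ (star m)‖ := norm_star _
      _ ≤ ‖ρ‖ * (C * ‖m‖) := h1.trans (by gcongr)
      _ = C * ‖ρ‖ * ‖m‖ := by ring

/-- The dual of a Banach `*`-bimodule (hence also its second dual) is a Banach `*`-bimodule. -/
instance StrongDual.instBanachStarBimodule [StarRing A] [BanachBimodule A M]
    [BanachStarBimodule A M] : BanachStarBimodule A (StrongDual ℂ M) where
  star_lact a ρ := by
    ext m
    simp [StrongDual.star_apply_eq, StrongDual.lact_apply, StrongDual.ract_apply,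
      BanachStarBimodule.star_lact]
  star_ract a ρ := by
    ext m
    simp [StrongDual.star_apply_eq, StrongDual.lact_apply, StrongDual.ract_apply,
      BanachStarBimodule.star_ract]

end Dual

/-- The Banach algebra `A` is zero product determined: every continuous bilinear map `φ` from
`A × A` into a Banach space with `φ(a, b) = 0` whenever `ab = 0` is of the form `φ(a, b) = T(ab)`
with `T` continuous and linear. (Target spaces in the universe of `A` lose
nothing: `X` may be replaced by the closed linear span of the range of `φ`, whose cardinality is
bounded by that of the sequences of finite combinations of elements of `A × A`.) -/
def IsZeroProductDetermined (A : Type u) [NonUnitalNormedRing A] [NormedSpace ℂ A] : Prop :=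
  ∀ (X : Type u) [NormedAddCommGroup X] [NormedSpace ℂ X] [CompleteSpace X]
    (φ : A →L[ℂ] A →L[ℂ] X),
    (∀ a b : A, a * b = 0 → φ a b = 0) → ∃ T : A →L[ℂ] X, ∀ a b : A, φ a b = T (a * b)

/-- The net `e` is a bounded approximate identity of `A` consisting of self-adjoint elements. -/
structure IsBoundedApproximateIdentity {A : Type u} [NonUnitalNormedRing A] [StarRing A]
    {Γ : Type w} [Preorder Γ] (e : Γ → A) : Prop where
  selfAdjoint : ∀ i, IsSelfAdjoint (e i)
  bounded : ∃ k : ℝ, 0 < k ∧ ∀ i, ‖e i‖ ≤ k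
  tendsto_right : ∀ a : A, Tendsto (fun i => ‖a * e i - a‖) atTop (𝓝 0)
  tendsto_left : ∀ a : A, Tendsto (fun i => ‖e i * a - a‖) atTop (𝓝 0)

/-- The bimodule `M` is essential: the linear span of the elements `a · m · b` is dense. -/
def IsEssentialBimodule (A : Type u) (M : Type v) [NonUnitalNormedRing A] [NormedSpace ℂ A]
    [NormedAddCommGroup M] [NormedSpace ℂ M] [BanachBimodule A M] : Prop :=
  Dense (Submodule.span ℂ {x : M | ∃ (a b : A) (m : M), x = a ⊳ₗ (m ⊲ᵣ b)} : Set M)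

/-- `M` is a dual bimodule: it is isomorphic, as a Banach bimodule, to the dual of some Banach
bimodule `E`. -/
def IsDualBimodule (A : Type u) (M : Type v) [NonUnitalNormedRing A] [NormedSpace ℂ A]
    [NormedAddCommGroup M] [NormedSpace ℂ M] [BanachBimodule A M] : Prop :=
  ∃ (E : Type v) (_ : NormedAddCommGroup E) (_ : NormedSpace ℂ E) (_ : CompleteSpace E)
    (_ : BanachBimodule A E) (Φ : M ≃L[ℂ] StrongDual ℂ E),
    (∀ (a : A) (m : M), Φ (a ⊳ₗ m) = a ⊳ₗ Φ m) ∧ (∀ (a : A) (m : M), Φ (m ⊲ᵣ a) = Φ m ⊲ᵣ a)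

/-- A `*`-derivation: a linear map with `Δ(ab) = a · Δ(b) + Δ(a) · b` and `Δ(a*) = Δ(a)*`. -/
structure IsStarDerivation {A : Type u} {N : Type v} [NonUnitalNormedRing A] [NormedSpace ℂ A]
    [StarRing A] [NormedAddCommGroup N] [NormedSpace ℂ N] [StarAddMonoid N]
    [BanachBimodule A N] (Δ : A →ₗ[ℂ] N) : Prop where
  map_mul : ∀ a b : A, Δ (a * b) = a ⊳ₗ Δ b + Δ a ⊲ᵣ b
  map_star : ∀ a : A, Δ (star a) = star (Δ a)

/-!
Write `D b = (δ b*)*`. The bilinear map `φ (a, b) = a · D b + δ a · b` vanishes whenever `ab = 0`,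
so zero product determination gives `φ (ab, c) = φ (a, bc)`, that is
`ab · D c + δ (ab) · c = a · D (bc) + δ a · bc`. Let `ξ ∈ M♯♯` be a weak-star cluster point of
`δ (e i)`. Putting `a = e i` and passing to the limit (`M` is essential, so `e i · m → m`) yields
`D (bc) + ξ · bc = b · D c + δ b · c` in `M♯♯` (`starConj_mul_add_ract_eq`). Putting then
`c = e i`, and using that the involution of `M♯♯` is weak-star continuous, yields
`D b + ξ · b = b · ξ* + δ b` (`starConj_add_ract_eq`). The second identity says that
`Δ b = δ b - ξ · b` commutes with the involutions, and together they say that `Δ` is a derivation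
(`isStarDerivation_subOrbitRight`).

For `ξ ∈ M`, note that by the first identity `ξ · bc` belongs to `M` for all `b, c`. If `A` is
unital, `ξ` may therefore be replaced by `ξ · 1`. If `M ≃ E♯`, the restriction map
`E♯♯♯ → E♯` gives a right module projection `P` of `M♯♯` onto `M` (`IsDualBimodule.exists_projection`),
and `P ξ · bc = P (ξ · bc) = ξ · bc`. Since the products `bc` are dense in `A`, `P ξ` acts on `A`
as `ξ` does.
-/

open NormedSpace

/-! ### Balanced bilinear maps on zero product determined algebras -/

section ZeroProduct

variable {A : Type u} [NonUnitalNormedRing A] [NormedSpace ℂ A]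

/-- Composing with functionals reduces the claim to scalar-valued bilinear maps, so the target space
may live in any universe. -/
theorem IsZeroProductDetermined.map_mul_left_eq {X : Type v} [NormedAddCommGroup X]
    [NormedSpace ℂ X] (hA : IsZeroProductDetermined A) (φ : A →L[ℂ] A →L[ℂ] X)
    (hφ : ∀ a b : A, a * b = 0 → φ a b = 0) (a b c : A) : φ (a * b) c = φ a (b * c) := by
  refine (SeparatingDual.eq_iff_forall_dual_eq (R := ℂ)).2 fun ρ => ?_
  let g : X →L[ℂ] ULift.{u} ℂ :=
    (ContinuousLinearEquiv.ulift (R₁ := ℂ) (M₁ := ℂ)).symm.toContinuousLinearMap.comp ρ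
  obtain ⟨T, hT⟩ := hA (ULift.{u} ℂ) ((ContinuousLinearMap.compL ℂ A X _ g).comp φ)
    fun a b hab => by simp [hφ a b hab]
  have h : g (φ (a * b) c) = g (φ a (b * c)) := by
    have h₁ := hT (a * b) c
    have h₂ := hT a (b * c)
    rw [← mul_assoc, ← h₁] at h₂
    exact h₂.symm
  exact congrArg ULift.down h

end ZeroProduct

/-! ### Approximate identities acting on essential bimodules -/

section Essential

variable {A : Type u} {M : Type v} {Γ : Type w} [NonUnitalNormedRing A] [StarRing A] [Preorder Γ]
  {e : Γ → A}

theorem IsBoundedApproximateIdentity.tendsto_mul_right (he : IsBoundedApproximateIdentity e)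
    (a : A) : Tendsto (fun i => a * e i) atTop (𝓝 a) :=
  tendsto_iff_norm_sub_tendsto_zero.2 (he.tendsto_right a)

theorem IsBoundedApproximateIdentity.tendsto_mul_left (he : IsBoundedApproximateIdentity e)
    (a : A) : Tendsto (fun i => e i * a) atTop (𝓝 a) :=
  tendsto_iff_norm_sub_tendsto_zero.2 (he.tendsto_left a)

variable [NormedSpace ℂ A] [NormedAddCommGroup M] [NormedSpace ℂ M] [BanachBimodule A M]

theorem IsBoundedApproximateIdentity.tendsto_lact (he : IsBoundedApproximateIdentity e)
    (hess : IsEssentialBimodule A M) (m : M) : Tendsto (fun i => e i ⊳ₗ m) atTop (𝓝 m) := by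
  obtain ⟨k, hk, hek⟩ := he.bounded
  set C : ℝ := ‖(BanachBimodule.lact : A →L[ℂ] M →L[ℂ] M)‖ * k with hC
  have hC0 : 0 ≤ C := by positivity
  have hbound : ∀ i (x : M), ‖e i ⊳ₗ x‖ ≤ C * ‖x‖ := fun i x =>
    ((BanachBimodule.lact : A →L[ℂ] M →L[ℂ] M).le_opNorm₂ (e i) x).trans (by
      rw [hC]; gcongr; exact hek i)
  have hspan : ∀ x ∈ Submodule.span ℂ {x : M | ∃ (a b : A) (m : M), x = a ⊳ₗ (m ⊲ᵣ b)},
      Tendsto (fun i => e i ⊳ₗ x) atTop (𝓝 x) := by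
    intro x hx
    induction hx using Submodule.span_induction with
    | mem x hx =>
      obtain ⟨a, b, m, rfl⟩ := hx
      simp only [lmulBimod, ← BanachBimodule.lact_mul]
      exact (((BanachBimodule.lact : A →L[ℂ] M →L[ℂ] M).flip (m ⊲ᵣ b)).continuous.tendsto a).comp
        (he.tendsto_mul_left a)
    | zero => simpa using tendsto_const_nhds
    | add x y _ _ hx hy => simpa using hx.add hy
    | smul c x _ hx => simpa using hx.const_smul c
  rw [Metric.tendsto_nhds]
  intro ε hε
  obtain ⟨x, hx, hmx⟩ := Metric.dense_iff.1 hess m (ε / (C + 2)) (by positivity)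
  rw [Metric.mem_ball, dist_eq_norm] at hx
  filter_upwards [Metric.tendsto_nhds.1 (hspan x hmx) (ε / (C + 2)) (by positivity)] with i hi
  rw [dist_eq_norm] at hi ⊢
  have hsplit : e i ⊳ₗ m - m = (e i ⊳ₗ x - x) + (x - m) - e i ⊳ₗ (x - m) := by
    simp only [lmulBimod, map_sub]; abel
  calc ‖e i ⊳ₗ m - m‖ ≤ ‖e i ⊳ₗ x - x‖ + ‖x - m‖ + ‖e i ⊳ₗ (x - m)‖ := by
        rw [hsplit]; exact (norm_sub_le _ _).trans (by gcongr; exact norm_add_le _ _)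
    _ ≤ ‖e i ⊳ₗ x - x‖ + ‖x - m‖ + C * ‖x - m‖ := by gcongr; exact hbound _ _
    _ < ε / (C + 2) + ε / (C + 2) + C * (ε / (C + 2)) := by
        have := mul_le_mul_of_nonneg_left hx.le hC0
        linarith
    _ = ε := by field_simp; ring

theorem IsBoundedApproximateIdentity.tendsto_ract [StarAddMonoid M] [StarModule ℂ M]
    [ContinuousStar M] [BanachStarBimodule A M] (he : IsBoundedApproximateIdentity e)
    (hess : IsEssentialBimodule A M) (m : M) : Tendsto (fun i => m ⊲ᵣ e i) atTop (𝓝 m) := by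
  have h := (he.tendsto_lact hess (star m)).star
  simpa only [BanachStarBimodule.star_lact, star_star, (he.selfAdjoint _).star_eq] using h

end Essential

/-! ### Star-derivations from two identities -/

section Derivation

variable {A : Type u} {M : Type v} [NonUnitalNormedRing A] [NormedSpace ℂ A]
  [NormedAddCommGroup M] [NormedSpace ℂ M]

variable (A) in
/-- The orbit map `a ↦ m · a` of an element `m` under the right action. -/
noncomputable def orbitRight [BanachBimodule A M] (m : M) : A →L[ℂ] M :=
  (BanachBimodule.ract : A →L[ℂ] M →L[ℂ] M).flip m

/-- The map `a ↦ f a - m · a`: what is left of `f` once the right multiplier given by `m` is removed. -/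
noncomputable def subOrbitRight [BanachBimodule A M] (f : A →L[ℂ] M) (m : M) : A →L[ℂ] M :=
  f - orbitRight A m

variable [StarRing A] [StarModule ℂ A] [ContinuousStar A] [StarAddMonoid M] [StarModule ℂ M]
  [ContinuousStar M]

/-- The conjugate `a ↦ (δ a*)*` of a continuous linear map between spaces with involution. -/
noncomputable def starConj (δ : A →L[ℂ] M) : A →L[ℂ] M where
  toFun a := star (δ (star a))
  map_add' a b := by simp
  map_smul' c a := by simp
  cont := (δ.continuous.comp continuous_star).star

theorem starConj_apply (δ : A →L[ℂ] M) (a : A) : starConj δ a = star (δ (star a)) := rfl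

/-- By `hone`, `f a - ξ · a` equals `(f a*)* - a · ξ*`; the Leibniz rule follows from `hmul` by using this
form for the arguments `ab` and `b`, and the original one for `a`. -/
theorem isStarDerivation_subOrbitRight [BanachBimodule A M] [BanachStarBimodule A M] {f : A →L[ℂ] M}
    {ξ : M} (hmul : ∀ b c, starConj f (b * c) + ξ ⊲ᵣ (b * c) = b ⊳ₗ starConj f c + f b ⊲ᵣ c)
    (hone : ∀ b, starConj f b + ξ ⊲ᵣ b = b ⊳ₗ star ξ + f b) :
    IsStarDerivation (subOrbitRight f ξ).toLinearMap := by
  set Δ := (subOrbitRight f ξ).toLinearMap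
  have hΔ : ∀ a, Δ a = f a - ξ ⊲ᵣ a := fun a => rfl
  have hΔ' : ∀ a, Δ a = starConj f a - a ⊳ₗ star ξ := fun a => by
    rw [hΔ, sub_eq_sub_iff_add_eq_add, hone, add_comm]
  refine ⟨fun a b => ?_, fun a => ?_⟩
  · rw [hΔ' (a * b), hΔ' b, hΔ a, eq_sub_of_add_eq (hmul a b)]
    simp only [map_sub, lmulBimod, rmulBimod, BanachBimodule.lact_mul, BanachBimodule.ract_mul]
    abel
  · rw [hΔ' (star a), hΔ a, star_sub, BanachStarBimodule.star_ract, starConj_apply, star_star]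

end Derivation

/-! ### The second dual -/

section SecondDual

variable {A : Type u} {M : Type v} [NonUnitalNormedRing A] [NormedSpace ℂ A]
  [NormedAddCommGroup M] [NormedSpace ℂ M]

theorem inclusionInDoubleDual_ract [BanachBimodule A M] (a : A) (m : M) :
    inclusionInDoubleDual ℂ M (m ⊲ᵣ a) = inclusionInDoubleDual ℂ M m ⊲ᵣ a := rfl

theorem inclusionInDoubleDual_star [StarAddMonoid M] [StarModule ℂ M] [ContinuousStar M] (m : M) :
    inclusionInDoubleDual ℂ M (star m) = star (inclusionInDoubleDual ℂ M m) := by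
  ext ρ
  simp [StrongDual.star_apply_eq]

/-- Banach–Alaoglu, for a bounded family in `M` viewed in the second dual. -/
theorem exists_tendsto_inclusionInDoubleDual {Γ : Type w} (x : Γ → M) {C : ℝ}
    (hx : ∀ i, ‖x i‖ ≤ C) (U : Ultrafilter Γ) :
    ∃ ξ : StrongDual ℂ (StrongDual ℂ M),
      ∀ ρ : StrongDual ℂ M, Tendsto (fun i => ρ (x i)) U (𝓝 (ξ ρ)) := by
  have hcomp := WeakDual.isCompact_closedBall (𝕜 := ℂ) (E := StrongDual ℂ M) 0 C
  obtain ⟨ξ, -, hξ⟩ := hcomp.ultrafilter_le_nhds'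
    (U.map fun i => StrongDual.toWeakDual (inclusionInDoubleDual ℂ M (x i)))
    (Filter.mem_map.2 <| Filter.univ_mem' fun i => by
      have h : ‖inclusionInDoubleDual ℂ M (x i)‖ ≤ C := (double_dual_bound ℂ M (x i)).trans (hx i)
      simpa using h)
  exact ⟨WeakDual.toStrongDual ξ, fun ρ =>
    ((WeakDual.eval_continuous ρ).tendsto ξ).comp (show Tendsto _ _ _ from hξ)⟩

/-- A dual bimodule is the range of a right module projection on its second dual: up to the
isomorphism with `E♯`, restrict functionals on `E♯♯` to `E`. -/
theorem IsDualBimodule.exists_projection [BanachBimodule A M] (hM : IsDualBimodule A M) :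
    ∃ P : StrongDual ℂ (StrongDual ℂ M) → M,
      (∀ m, P (inclusionInDoubleDual ℂ M m) = m) ∧ ∀ Λ (a : A), P (Λ ⊲ᵣ a) = P Λ ⊲ᵣ a := by
  obtain ⟨E, _, _, _, _, Φ, -, hΦ⟩ := hM
  -- `ev x` is the functional `m ↦ Φ m x` on `M`.
  let ev : E →L[ℂ] StrongDual ℂ M := Φ.toContinuousLinearMap.flip
  refine ⟨fun Λ => Φ.symm (Λ.comp ev), fun m => ?_, fun Λ a => ?_⟩
  · rw [Φ.symm_apply_eq]
    rfl
  · rw [Φ.symm_apply_eq, hΦ, Φ.apply_symm_apply]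
    ext x
    have h : a ⊳ₗ ev x = ev (a ⊳ₗ x) := by
      ext m
      change Φ (m ⊲ᵣ a) x = Φ m (a ⊳ₗ x)
      rw [hΦ]
      rfl
    change Λ (a ⊳ₗ ev x) = Λ (ev (a ⊳ₗ x))
    rw [h]

end SecondDual

/-! ### The two identities in the second dual -/

section Identities

variable {A : Type u} {M : Type v} {Γ : Type w}
  [NonUnitalNormedRing A] [NormedSpace ℂ A] [StarRing A] [StarModule ℂ A] [ContinuousStar A]
  [NormedAddCommGroup M] [NormedSpace ℂ M] [StarAddMonoid M] [StarModule ℂ M] [ContinuousStar M]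
  [BanachBimodule A M]

theorem lact_starConj_add_ract_eq (hzpd : IsZeroProductDetermined A) (δ : A →L[ℂ] M)
    (hδ : ∀ a b : A, a * star b = 0 → a ⊳ₗ star (δ b) + δ a ⊲ᵣ star b = 0) (a b c : A) :
    (a * b) ⊳ₗ starConj δ c + δ (a * b) ⊲ᵣ c = a ⊳ₗ starConj δ (b * c) + δ a ⊲ᵣ (b * c) :=
  hzpd.map_mul_left_eq
    (((BanachBimodule.lact : A →L[ℂ] M →L[ℂ] M).flip.comp (starConj δ)).flip
      + (BanachBimodule.ract : A →L[ℂ] M →L[ℂ] M).flip.comp δ)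
    (fun a b hab => by simpa [starConj_apply] using hδ a (star b) (by simpa using hab)) a b c

variable [Preorder Γ] {e : Γ → A} {U : Ultrafilter Γ}
  {ξ : StrongDual ℂ (StrongDual ℂ M)} {δ : A →L[ℂ] M}

/-- The limit of `lact_starConj_add_ract_eq` at `a = e i`: the terms in which `e i` acts converge in
norm, and `δ (e i) · bc` converges weak-star to `ξ · bc`. -/
theorem starConj_mul_add_ract_eq (hzpd : IsZeroProductDetermined A)
    (he : IsBoundedApproximateIdentity e) (hess : IsEssentialBimodule A M)
    (hδ : ∀ a b : A, a * star b = 0 → a ⊳ₗ star (δ b) + δ a ⊲ᵣ star b = 0)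
    (hU : (U : Filter Γ) ≤ atTop)
    (hξ : ∀ ρ : StrongDual ℂ M, Tendsto (fun i => ρ (δ (e i))) U (𝓝 (ξ ρ))) (b c : A) :
    inclusionInDoubleDual ℂ M (starConj δ (b * c)) + ξ ⊲ᵣ (b * c) =
      inclusionInDoubleDual ℂ M (b ⊳ₗ starConj δ c + δ b ⊲ᵣ c) := by
  ext ρ
  have hleft : Tendsto (fun i => ρ (e i ⊳ₗ starConj δ (b * c) + δ (e i) ⊲ᵣ (b * c))) U
      (𝓝 (ρ (starConj δ (b * c)) + ξ ((b * c) ⊳ₗ ρ))) := by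
    simp only [map_add]
    exact ((ρ.continuous.tendsto _).comp ((he.tendsto_lact hess _).mono_left hU)).add (hξ _)
  have hmul := (he.tendsto_mul_left b).mono_left hU
  have hright : Tendsto (fun i => ρ ((e i * b) ⊳ₗ starConj δ c + δ (e i * b) ⊲ᵣ c)) U
      (𝓝 (ρ (b ⊳ₗ starConj δ c + δ b ⊲ᵣ c))) := by
    have hcont : Continuous fun a : A => ρ (a ⊳ₗ starConj δ c + δ a ⊲ᵣ c) := by
      simp only [lmulBimod, rmulBimod]
      fun_prop
    exact (hcont.tendsto b).comp hmul
  simp only [lact_starConj_add_ract_eq hzpd δ hδ] at hright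
  exact tendsto_nhds_unique hleft hright

/-- The weak-star limit of `starConj_mul_add_ract_eq` at `c = e i`, where `starConj δ (e i) = (δ (e i))*`
converges to `ξ*`. -/
theorem starConj_add_ract_eq [BanachStarBimodule A M] (hzpd : IsZeroProductDetermined A)
    (he : IsBoundedApproximateIdentity e) (hess : IsEssentialBimodule A M)
    (hδ : ∀ a b : A, a * star b = 0 → a ⊳ₗ star (δ b) + δ a ⊲ᵣ star b = 0)
    (hU : (U : Filter Γ) ≤ atTop)
    (hξ : ∀ ρ : StrongDual ℂ M, Tendsto (fun i => ρ (δ (e i))) U (𝓝 (ξ ρ))) (b : A) :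
    inclusionInDoubleDual ℂ M (starConj δ b) + ξ ⊲ᵣ b =
      b ⊳ₗ star ξ + inclusionInDoubleDual ℂ M (δ b) := by
  ext ρ
  have hleft : Tendsto (fun i => ρ (starConj δ (b * e i)) + (ξ ⊲ᵣ (b * e i)) ρ) U
      (𝓝 (ρ (starConj δ b) + (ξ ⊲ᵣ b) ρ)) := by
    have hcont : Continuous fun a : A => ρ (starConj δ a) + (ξ ⊲ᵣ a) ρ := by
      simp only [rmulBimod]
      fun_prop
    exact (hcont.tendsto b).comp ((he.tendsto_mul_right b).mono_left hU)
  have hright : Tendsto (fun i => ρ (b ⊳ₗ starConj δ (e i) + δ b ⊲ᵣ e i)) U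
      (𝓝 ((b ⊳ₗ star ξ) ρ + ρ (δ b))) := by
    simp only [map_add]
    refine Tendsto.add ?_
      ((ρ.continuous.tendsto _).comp ((he.tendsto_ract hess (δ b)).mono_left hU))
    simpa [StrongDual.lact_apply, StrongDual.ract_apply, StrongDual.star_apply_eq, starConj_apply,
      (he.selfAdjoint _).star_eq] using (hξ (star (ρ ⊲ᵣ b))).star
  refine tendsto_nhds_unique hleft (hright.congr fun i => ?_)
  exact (DFunLike.congr_fun (starConj_mul_add_ract_eq hzpd he hess hδ hU hξ b (e i)) ρ).symm

end Identities

/-! ### The decomposition -/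

theorem theorem2p1 {A : Type u} {M : Type v} {Γ : Type w}
    -- `A` is a Banach `*`-algebra over `ℂ`
    [NonUnitalNormedRing A] [NormedSpace ℂ A] [IsScalarTower ℂ A A] [SMulCommClass ℂ A A]
    [CompleteSpace A] [StarRing A] [StarModule ℂ A] [ContinuousStar A]
    -- `M` is a Banach `*`-`A`-bimodule
    [NormedAddCommGroup M] [NormedSpace ℂ M] [CompleteSpace M]
    [StarAddMonoid M] [StarModule ℂ M] [ContinuousStar M]
    [BanachBimodule A M] [BanachStarBimodule A M]
    (hzpd : IsZeroProductDetermined A)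
    [Preorder Γ] [Nonempty Γ] [IsDirectedOrder Γ] (e : Γ → A)
    (he : IsBoundedApproximateIdentity e)
    (hess : IsEssentialBimodule A M)
    (δ : A →L[ℂ] M)
    (hδ : ∀ a b : A, a * star b = 0 → a ⊳ₗ star (δ b) + δ a ⊲ᵣ star b = 0) :
    (∃ (Δ : A →ₗ[ℂ] StrongDual ℂ (StrongDual ℂ M)) (ξ : StrongDual ℂ (StrongDual ℂ M)),
      IsStarDerivation (N := StrongDual ℂ (StrongDual ℂ M)) Δ ∧
        ∀ a : A, NormedSpace.inclusionInDoubleDual ℂ M (δ a) = Δ a + ξ ⊲ᵣ a) ∧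
    ((∃ one : A, ∀ a : A, one * a = a ∧ a * one = a) ∨ IsDualBimodule A M →
      ∃ (Δ : A →ₗ[ℂ] StrongDual ℂ (StrongDual ℂ M)) (ξ : M),
        IsStarDerivation (N := StrongDual ℂ (StrongDual ℂ M)) Δ ∧
          ∀ a : A, NormedSpace.inclusionInDoubleDual ℂ M (δ a) =
            Δ a + NormedSpace.inclusionInDoubleDual ℂ M ξ ⊲ᵣ a) := by
  obtain ⟨k, hk, hek⟩ := he.bounded
  obtain ⟨ξ, hξ⟩ := exists_tendsto_inclusionInDoubleDual (fun i => δ (e i))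
    (fun i => (δ.le_opNorm (e i)).trans (mul_le_mul_of_nonneg_left (hek i) (norm_nonneg δ)))
    (Ultrafilter.of atTop)
  have hmul := starConj_mul_add_ract_eq hzpd he hess hδ (Ultrafilter.of_le _) hξ
  have hone := starConj_add_ract_eq hzpd he hess hδ (Ultrafilter.of_le _) hξ
  have hconj : ∀ a, starConj ((inclusionInDoubleDual ℂ M).comp δ) a =
      inclusionInDoubleDual ℂ M (starConj δ a) := fun a =>
    (inclusionInDoubleDual_star (δ (star a))).symm
  let Δ := (subOrbitRight ((inclusionInDoubleDual ℂ M).comp δ) ξ).toLinearMap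
  have hder : IsStarDerivation Δ := by
    refine isStarDerivation_subOrbitRight (fun b c => ?_) fun b => ?_
    · rw [hconj, hconj, hmul, map_add]
      rfl
    · rw [hconj, hone]
      rfl
  have hdec : ∀ a, inclusionInDoubleDual ℂ M (δ a) = Δ a + ξ ⊲ᵣ a := fun a =>
    (sub_add_cancel (inclusionInDoubleDual ℂ M (δ a)) (ξ ⊲ᵣ a)).symm
  refine ⟨⟨Δ, ξ, hder, hdec⟩, fun hcase => ?_⟩
  have hmem : ∀ b c : A, ∃ m : M, ξ ⊲ᵣ (b * c) = inclusionInDoubleDual ℂ M m := fun b c =>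
    ⟨b ⊳ₗ starConj δ c + δ b ⊲ᵣ c - starConj δ (b * c), by
      rw [map_sub, ← hmul]
      exact (add_sub_cancel_left (inclusionInDoubleDual ℂ M (starConj δ (b * c)))
        (ξ ⊲ᵣ (b * c))).symm⟩
  suffices h : ∃ x : M, ∀ a : A, ξ ⊲ᵣ a = inclusionInDoubleDual ℂ M x ⊲ᵣ a by
    obtain ⟨x, hx⟩ := h
    exact ⟨Δ, x, hder, fun a => by rw [← hx, hdec]⟩
  rcases hcase with ⟨one, h1⟩ | hM
  · obtain ⟨x, hx⟩ := hmem one one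
    refine ⟨x, fun a => ?_⟩
    rw [← hx]
    simp only [rmulBimod, ← BanachBimodule.ract_mul, (h1 _).1]
  · obtain ⟨P, hP, hPr⟩ := hM.exists_projection
    refine ⟨P ξ, fun a => ?_⟩
    have hprod : ∀ b c : A, ξ ⊲ᵣ (b * c) = inclusionInDoubleDual ℂ M (P ξ) ⊲ᵣ (b * c) := by
      intro b c
      obtain ⟨m, hm⟩ := hmem b c
      rw [← inclusionInDoubleDual_ract, ← hPr, hm, hP]
    -- Both sides are continuous in `a`, and `a` is the limit of the products `a * e i`.
    have hlim : ∀ Λ : StrongDual ℂ (StrongDual ℂ M),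
        Tendsto (fun i => Λ ⊲ᵣ (a * e i)) atTop (𝓝 (Λ ⊲ᵣ a)) := fun Λ =>
      ((orbitRight A Λ).continuous.tendsto a).comp (he.tendsto_mul_right a)
    exact tendsto_nhds_unique (hlim ξ) ((hlim _).congr fun i => (hprod a (e i)).symm)
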